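/- **Setting.** Fix a small category $\mathrm{Type}$ with finite products (the algebraic theory of types). A profunctor $P\colon C ⇸ D$ between small categories is a functor $C^{op}\times D\to\mathrm{Set}$; a 2-cell $P\Rightarrow Q$ in $\mathbb{P}\mathrm{rof}$ framed by functors $F\colon C\to C'$, $G\colon D\to D'$ (where $Q\colon C' ⇸ D'$) is a natural family $P(c,d)\to Q(Fc,Gd)$; composition is $(P\odot Q)(c,e)=\int^{d}P(c,d)\times Q(d,e)$. A *schema* $S$ is a small category $S_e$ with a profunctor $S_o\colon S_e ⇸ \mathrm{Type}$ such that each $S_o(s,-)$ preserves finite products. Its collage $\tilde S$ is the category whose objects are those of $S_e$ and of $\mathrm{Type}$, with $\tilde S(s,s')=S_e(s,s')$, $\tilde S(\tau,\tau')=\mathrm{Type}(\tau,\tau')$, $\tilde S(s,\tau)=S_o(s,\tau)$, $\tilde S(\tau,s)=\emptyset$. An *$S$-instance* is a functor $\tilde S\to\mathrm{Set}$ whose restriction to $\mathrm{Type}$ preserves finite products; $S\text{-}\mathrm{Inst}$ is the full subcategory of these, and $\mathbf y\colon\tilde S^{op}\to S\text{-}\mathrm{Inst}$ is the Yoneda embedding.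 A *schema mapping* $F\colon R\to R'$ is a functor $F_e\colon R_e\to R'_e$ with a 2-cell $F_o\colon R_o\Rightarrow R'_o$ framed by $F_e$ and $\mathrm{id}_{\mathrm{Type}}$; it induces $\tilde F\colon\tilde R\to\tilde R'$, the identity on types, and $\Delta_F\colon R'\text{-}\mathrm{Inst}\to R\text{-}\mathrm{Inst}$ by precomposition with $\tilde F$. A *bimodule* $M\colon R ⇸ S$ is a functor $M\colon\tilde R^{op}\to S\text{-}\mathrm{Inst}$ that equals $\mathbf y$ on $\mathrm{Type}$; a morphism of bimodules is a natural transformation that is the identity on $\mathrm{Type}$. For $r\in R_e$, $s\in S_e$, $\tau\in\mathrm{Type}$ put $M_e(r,s)=M(r)(s)$ and $M_t(r,\tau)=M(r)(\tau)$, which are profunctors $M_e\colon R_e ⇸ S_e$ and $M_t\colon R_e ⇸ \mathrm{Type}$; let $M_{att}\colon M_e\odot S_o\Rightarrow M_t$ be given by $[m,a]\mapsto M(r)(a)(m)$, and $M_{ret}\colon R_o\Rightarrow M_t$ by sending $a\in R_o(r,\tau)$ to the image of $\mathrm{id}_\tau\in\mathbf y(\tau)(\tau)=M(\tau)(\tau)$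 under $M(a)\colon M(\tau)\to M(r)$. For schema mappings $F\colon R\to R'$, $G\colon S\to S'$ and a bimodule $M'\colon R' ⇸ S'$, a *2-cell $\theta\colon M\Rightarrow M'$ in $\mathbb{D}\mathrm{ata}$ framed by $F$ and $G$* is a morphism of bimodules $M\to\Delta_G\circ M'\circ\tilde F^{op}$. In either double category, a 2-cell $\theta\colon M\Rightarrow M'$ framed by $F,G$ is *cartesian* if every 2-cell $\chi\colon L\Rightarrow M'$ framed by composites $F\circ H$, $G\circ K$ is the vertical composite of $\theta$ with a unique 2-cell $L\Rightarrow M$ framed by $H,K$. **Statement.** Let $F\colon R\to R'$ and $G\colon S\to S'$ be schema mappings and $M\colon R ⇸ S$, $M'\colon R' ⇸ S'$ bimodules. 1. Sending $\theta$ to its restrictions $\theta_e$ (components $M_e(r,s)\to M'_e(F_er,G_es)$) and $\theta_t$ (components $M_t(r,\tau)\to M'_t(F_er,\tau)$) is a bijection from the 2-cells $\theta\colon M\Rightarrow M'$ in $\mathbb{D}\mathrm{ata}$ framed by $F,G$ to the pairs of 2-cells in $\mathbb{P}\mathrm{rof}$, $\theta_e\colon M_e\Rightarrow M'_e$ framed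 by $F_e,G_e$ and $\theta_t\colon M_t\Rightarrow M'_t$ framed by $F_e,\mathrm{id}_{\mathrm{Type}}$, that satisfy $$M'_{att}\circ(\theta_e\odot G_o)=\theta_t\circ M_{att},\qquad \theta_t\circ M_{ret}=M'_{ret}\circ F_o .$$ 2. A 2-cell $\theta$ in $\mathbb{D}\mathrm{ata}$ framed by $F,G$ is cartesian if and only if $\theta_e$ and $\theta_t$ are both cartesian in $\mathbb{P}\mathrm{rof}$. -/

import Mathlib

open CategoryTheory CategoryTheory.Limits Opposite

universe u

/-! ### The double category of profunctors -/

/-- Profunctors `C ⇸ D` between small categories: functors `Cᵒᵖ × D ⥤ Type`, in curried form. -/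
abbrev Prof (C D : Type u) [SmallCategory C] [SmallCategory D] : Type (u + 1) :=
  Cᵒᵖ ⥤ D ⥤ Type u

namespace Prof

section
variable {C D C' D' C'' D'' : Type u} [SmallCategory C] [SmallCategory D] [SmallCategory C']
  [SmallCategory D'] [SmallCategory C''] [SmallCategory D'']

/-- Restriction `Q ↦ Q(F -, G -)` of profunctors along functors `F` and `G`. -/
def restrict (F : C ⥤ C') (G : D ⥤ D') : Prof C' D' ⥤ Prof C D :=
  (Functor.whiskeringLeft Cᵒᵖ C'ᵒᵖ (D' ⥤ Type u)).obj F.op ⋙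
    (Functor.whiskeringRight Cᵒᵖ (D' ⥤ Type u) (D ⥤ Type u)).obj
      ((Functor.whiskeringLeft D D' (Type u)).obj G)

/-- A 2-cell from `P : C ⇸ D` to `Q : C' ⇸ D'` with left frame `F` and right frame `G`: a natural
family of functions `P(c, d) → Q(F c, G d)`. -/
abbrev Cell (F : C ⥤ C') (G : D ⥤ D') (P : Prof C D) (Q : Prof C' D') : Type u :=
  P ⟶ (restrict F G).obj Q

/-- Vertical composition of 2-cells. -/
def Cell.vcomp {F : C ⥤ C'} {G : D ⥤ D'} {F' : C' ⥤ C''} {G' : D' ⥤ D''}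
    {P : Prof C D} {Q : Prof C' D'} {W : Prof C'' D''}
    (φ : Cell F G P Q) (ψ : Cell F' G' Q W) : Cell (F ⋙ F') (G ⋙ G') P W :=
  φ ≫ (restrict F G).map ψ

/-- A 2-cell `φ` with frames `F` and `G` is cartesian if every 2-cell into its codomain whose
frames factor through `F` and `G` factors uniquely through `φ`. -/
def Cell.IsCartesian {F : C ⥤ C'} {G : D ⥤ D'} {P : Prof C D} {Q : Prof C' D'}
    (φ : Cell F G P Q) : Prop :=
  ∀ ⦃A B : Type u⦄ [SmallCategory A] [SmallCategory B] (H : A ⥤ C) (K : B ⥤ D) (W : Prof A B)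
    (χ : Cell (H ⋙ F) (K ⋙ G) W Q), ∃! ψ : Cell H K W P, ψ.vcomp φ = χ

end

section
variable {C D E C' D' E' : Type u} [SmallCategory C] [SmallCategory D] [SmallCategory E]
  [SmallCategory C'] [SmallCategory D'] [SmallCategory E']

/-- The relation on `Σ d, P(c, d) × Q(d, e)` that generates the coend. -/
inductive CoendRel (P : Prof C D) (Q : Prof D E) (c : Cᵒᵖ) (e : E) :
    (Σ d : D, (P.obj c).obj d × (Q.obj (op d)).obj e) →
    (Σ d : D, (P.obj c).obj d × (Q.obj (op d)).obj e) → Prop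
  | mk {d d' : D} (f : d ⟶ d') (p : (P.obj c).obj d) (q : (Q.obj (op d')).obj e) :
      CoendRel P Q c e ⟨d', (P.obj c).map f p, q⟩ ⟨d, p, (Q.map f.op).app e q⟩

theorem CoendRel.mk' {P : Prof C D} {Q : Prof D E} {c : Cᵒᵖ} {e : E} {d d' : D} (f : d ⟶ d')
    {p : (P.obj c).obj d} {p' : (P.obj c).obj d'} {q : (Q.obj (op d')).obj e}
    {q' : (Q.obj (op d)).obj e} (hp : p' = (P.obj c).map f p) (hq : q' = (Q.map f.op).app e q) :
    CoendRel P Q c e ⟨d', p', q⟩ ⟨d, p, q'⟩ := by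
  subst hp hq
  exact CoendRel.mk f p q

/-- The composite profunctor `P ⊙ Q`, with value the coend `∫^d P(c, d) × Q(d, e)`. -/
def comp (P : Prof C D) (Q : Prof D E) : Prof C E where
  obj c :=
    { obj := fun e => Quot (CoendRel P Q c e)
      map := fun {e e'} g => ↾(Quot.map
        (fun x => ⟨x.1, x.2.1, (Q.obj (op x.1)).map g x.2.2⟩) (by
          rintro _ _ ⟨f, p, q⟩
          exact CoendRel.mk' f rfl (NatTrans.naturality_apply (Q.map f.op) g q).symm))
      map_id := by
        intro e
        ext ⟨x⟩
        simp [Quot.map]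
      map_comp := by
        intro e e' e'' g g'
        ext ⟨x⟩
        simp [Quot.map] }
  map {c c'} f :=
    { app := fun e => ↾(Quot.map
        (fun x => ⟨x.1, (P.map f).app x.1 x.2.1, x.2.2⟩) (by
          rintro _ _ ⟨g, p, q⟩
          exact CoendRel.mk' g (NatTrans.naturality_apply (P.map f) g p) rfl))
      naturality := by
        intro e e' g
        ext ⟨x⟩
        rfl }
  map_id := by
    intro c
    ext e ⟨x⟩
    simp [Quot.map]
  map_comp := by
    intro c c' c'' f g
    ext e ⟨x⟩
    simp [Quot.map]

/-- Horizontal composition of 2-cells. -/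
def Cell.hcomp {F : C ⥤ C'} {G : D ⥤ D'} {H : E ⥤ E'} {P : Prof C D} {Q : Prof D E}
    {P' : Prof C' D'} {Q' : Prof D' E'} (φ : Cell F G P P') (ψ : Cell G H Q Q') :
    Cell F H (P.comp Q) (P'.comp Q') where
  app c :=
    { app := fun e => ↾(Quot.map
        (fun x => ⟨G.obj x.1, (φ.app c).app x.1 x.2.1, (ψ.app (op x.1)).app e x.2.2⟩) (by
          rintro _ _ ⟨f, p, q⟩
          exact CoendRel.mk' (G.map f) (NatTrans.naturality_apply (φ.app c) f p)
            (ConcreteCategory.congr_hom (NatTrans.congr_app (ψ.naturality f.op) e) q)))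
      naturality := by
        intro e e' g
        ext ⟨x⟩
        exact congrArg (fun q => Quot.mk (CoendRel P' Q' (F.op.obj c) (H.obj e'))
          ⟨G.obj x.1, (φ.app c).app x.1 x.2.1, q⟩)
          (NatTrans.naturality_apply (ψ.app (op x.1)) g x.2.2) }
  naturality := by
    intro c c' f
    ext e ⟨x⟩
    exact congrArg (fun p => Quot.mk (CoendRel P' Q' (F.op.obj c') (H.obj e))
      ⟨G.obj x.1, p, (ψ.app (op x.1)).app e x.2.2⟩)
      (ConcreteCategory.congr_hom (NatTrans.congr_app (φ.naturality f) x.1) x.2.1)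

end

section
variable {C D C' D' C'' D'' : Type u} [SmallCategory C] [SmallCategory D] [SmallCategory C']
  [SmallCategory D'] [SmallCategory C''] [SmallCategory D'']

/-- Objects of the collage of `P : C ⇸ D`: the disjoint union of the objects of `C` and `D`. -/
inductive Collage (P : Prof C D) : Type u
  | left (c : C) : Collage P
  | right (d : D) : Collage P

namespace Collage

/-- Morphisms of the collage: those of `C`, those of `D`, the elements of `P(c, d)` from `c` to
`d`, and none from `d` to `c`. -/
def Hom {P : Prof C D} : Collage P → Collage P → Type u
  | left c, left c' => c ⟶ c'
  | left c, right d => (P.obj (op c)).obj d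
  | right _, left _ => PEmpty
  | right d, right d' => d ⟶ d'

/-- Identities of the collage. -/
def idHom {P : Prof C D} : (x : Collage P) → Hom x x
  | left c => 𝟙 c
  | right d => 𝟙 d

/-- Composition in the collage, given by the two actions on `P`. -/
def compHom {P : Prof C D} : {x y z : Collage P} → Hom x y → Hom y z → Hom x z
  | left c, left c', left c'', f, g => ((f : c ⟶ c') ≫ (g : c' ⟶ c'') : c ⟶ c'')
  | left c, left c', right d, f, p =>
      ((P.map (Quiver.Hom.op (f : c ⟶ c'))).app d p : (P.obj (op c)).obj d)
  | left c, right d, right d', p, g => ((P.obj (op c)).map (g : d ⟶ d') p : (P.obj (op c)).obj d')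
  | right d, right d', right d'', f, g => ((f : d ⟶ d') ≫ (g : d' ⟶ d'') : d ⟶ d'')
  | right _, left _, _, f, _ => PEmpty.elim f
  | _, right _, left _, _, g => PEmpty.elim g

instance (P : Prof C D) : SmallCategory (Collage P) where
  Hom := Hom
  id := idHom
  comp := compHom
  id_comp := by
    rintro (c | d) (c' | d') f
    · exact Category.id_comp (obj := C) f
    · exact ConcreteCategory.congr_hom (NatTrans.congr_app (P.map_id (op c)) d') f
    · exact PEmpty.elim f
    · exact Category.id_comp (obj := D) f
  comp_id := by
    rintro (c | d) (c' | d') f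
    · exact Category.comp_id (obj := C) f
    · exact ConcreteCategory.congr_hom ((P.obj (op c)).map_id d') f
    · exact PEmpty.elim f
    · exact Category.comp_id (obj := D) f
  assoc := by
    rintro (a | a) (b | b) (c | c) (d | d) f g h <;>
      first
      | exact PEmpty.elim f
      | exact PEmpty.elim g
      | exact PEmpty.elim h
      | exact Category.assoc (obj := C) f g h
      | exact Category.assoc (obj := D) f g h
      | skip
    · exact ConcreteCategory.congr_hom (NatTrans.congr_app
        (P.map_comp (Quiver.Hom.op (g : b ⟶ c)) (Quiver.Hom.op (f : a ⟶ b))) d) h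
    · exact (NatTrans.naturality_apply (P.map (Quiver.Hom.op (f : a ⟶ b))) (h : c ⟶ d) g).symm
    · exact (ConcreteCategory.congr_hom ((P.obj (op a)).map_comp (g : b ⟶ c) (h : c ⟶ d)) f).symm

/-- The inclusion of `C` in the collage. -/
def inLeft (P : Prof C D) : C ⥤ Collage P where
  obj := left
  map f := f

/-- The inclusion of `D` in the collage. -/
def inRight (P : Prof C D) : D ⥤ Collage P where
  obj := right
  map f := f

/-- The element `p ∈ P(c, d)` as a morphism of the collage. -/
def ofElem {P : Prof C D} {c : C} {d : D} (p : (P.obj (op c)).obj d) :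
    (inLeft P).obj c ⟶ (inRight P).obj d := p

/-- The action on objects of the functor between collages induced by a 2-cell. -/
def mapObj (F : C ⥤ C') (G : D ⥤ D') (P : Prof C D) (Q : Prof C' D') : Collage P → Collage Q
  | left c => left (F.obj c)
  | right d => right (G.obj d)

/-- The action on morphisms of the functor between collages induced by a 2-cell. -/
def mapHom {F : C ⥤ C'} {G : D ⥤ D'} {P : Prof C D} {Q : Prof C' D'} (φ : Cell F G P Q) :
    {x y : Collage P} → (x ⟶ y) → (mapObj F G P Q x ⟶ mapObj F G P Q y)
  | left c, left c', f => F.map (f : c ⟶ c')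
  | left c, right d, p => ((φ.app (op c)).app d p : (Q.obj (op (F.obj c))).obj (G.obj d))
  | right _, left _, f => PEmpty.elim f
  | right d, right d', f => G.map (f : d ⟶ d')

/-- The functor between collages induced by a 2-cell. -/
def map {F : C ⥤ C'} {G : D ⥤ D'} {P : Prof C D} {Q : Prof C' D'} (φ : Cell F G P Q) :
    Collage P ⥤ Collage Q where
  obj := mapObj F G P Q
  map := mapHom φ
  map_id := by
    rintro (c | d)
    · exact F.map_id c
    · exact G.map_id d
  map_comp := by
    rintro (a | a) (b | b) (c | c) f g <;>
      first
      | exact PEmpty.elim f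
      | exact PEmpty.elim g
      | exact F.map_comp f g
      | exact G.map_comp f g
      | skip
    · exact ConcreteCategory.congr_hom
        (NatTrans.congr_app (φ.naturality (Quiver.Hom.op (f : a ⟶ b))) c) g
    · exact NatTrans.naturality_apply (φ.app (op a)) (g : b ⟶ c) f

theorem map_vcomp {F : C ⥤ C'} {G : D ⥤ D'} {F' : C' ⥤ C''} {G' : D' ⥤ D''}
    {P : Prof C D} {Q : Prof C' D'} {W : Prof C'' D''} (φ : Cell F G P Q) (ψ : Cell F' G' Q W) :
    map (φ.vcomp ψ) = map φ ⋙ map ψ := by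
  refine Functor.hext ?_ ?_
  · rintro (c | d) <;> rfl
  · rintro (c | d) (c' | d') f
    · rfl
    · rfl
    · exact PEmpty.elim f
    · rfl

end Collage

end

end Prof

/-! ### Schemas, instances and schema mappings

`T` plays the role of the fixed algebraic theory of types; only its finite products matter. -/

/-- A database schema: a small category of entities, with an algebraic (that is, preserving finite
products on the right) profunctor of observables from entities to types. -/
structure Schema (T : Type u) [SmallCategory T] where
  /-- The entity category. -/
  Ent : Type u
  [smallCategory : SmallCategory Ent]
  /-- The observables. -/
  obs : Prof Ent T
  algebraic : ∀ e : Entᵒᵖ, PreservesFiniteProducts (obs.obj e)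

attribute [instance] Schema.smallCategory

namespace Schema

variable {T : Type u} [SmallCategory T]

/-- The collage of a schema. -/
abbrev Col (S : Schema T) : Type u := Prof.Collage S.obs

/-- The inclusion of entities in the collage. -/
abbrev inE (S : Schema T) : S.Ent ⥤ S.Col := Prof.Collage.inLeft S.obs

/-- The inclusion of types in the collage. -/
abbrev inT (S : Schema T) : T ⥤ S.Col := Prof.Collage.inRight S.obs

/-- The property that a functor on the collage restricts to an algebra on types. -/
def IsInstance (S : Schema T) : ObjectProperty (S.Col ⥤ Type u) :=
  fun I => PreservesFiniteProducts (S.inT ⋙ I)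

/-- The category of instances on a schema. -/
abbrev Inst (S : Schema T) : Type (u + 1) := S.IsInstance.FullSubcategory

theorem isInstance_coyoneda (S : Schema T) (x : S.Colᵒᵖ) : S.IsInstance (coyoneda.obj x) := by
  obtain ⟨c | d⟩ := x
  · exact S.algebraic (op c)
  · exact (inferInstance : PreservesFiniteProducts (coyoneda.obj (op d)))

/-- The Yoneda embedding, which sends an object of the collage to the instance it represents. -/
def yon (S : Schema T) : S.Colᵒᵖ ⥤ S.Inst :=
  S.IsInstance.lift coyoneda S.isInstance_coyoneda

/-- A schema mapping: a functor between entities, with a 2-cell between observables that is framed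
by it and by the identity of types. -/
structure Mapping (R S : Schema T) where
  /-- The functor between entities. -/
  ent : R.Ent ⥤ S.Ent
  /-- The 2-cell between observables. -/
  obs : Prof.Cell ent (𝟭 T) R.obs S.obs

namespace Mapping

variable {Q R S : Schema T}

/-- Composition of schema mappings. -/
def comp (F : Q.Mapping R) (G : R.Mapping S) : Q.Mapping S where
  ent := F.ent ⋙ G.ent
  obs := F.obs.vcomp G.obs

/-- The functor between collages induced by a schema mapping. -/
def col (F : R.Mapping S) : R.Col ⥤ S.Col := Prof.Collage.map F.obs

theorem col_comp (F : Q.Mapping R) (G : R.Mapping S) : (F.comp G).col = F.col ⋙ G.col :=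
  Prof.Collage.map_vcomp F.obs G.obs

/-- The functor `Δ` between instance categories, restriction along the functor of collages. -/
def delta (F : R.Mapping S) : S.Inst ⥤ R.Inst :=
  R.IsInstance.lift (S.IsInstance.ι ⋙ (Functor.whiskeringLeft _ _ (Type u)).obj F.col)
    (fun I => I.property)

theorem delta_comp (F : Q.Mapping R) (G : R.Mapping S) :
    (F.comp G).delta = G.delta ⋙ F.delta := by
  have key : ∀ (K : Q.Col ⥤ S.Col) (_ : K = F.col ⋙ G.col)
      (hK : ∀ I, Q.IsInstance
        ((S.IsInstance.ι ⋙ (Functor.whiskeringLeft _ _ (Type u)).obj K).obj I)),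
      Q.IsInstance.lift (S.IsInstance.ι ⋙ (Functor.whiskeringLeft _ _ (Type u)).obj K) hK =
        G.delta ⋙ F.delta := by
    rintro _ rfl hK
    rfl
  exact key _ (col_comp F G) _

theorem yon_delta (F : R.Mapping S) : S.inT.op ⋙ S.yon ⋙ F.delta = R.inT.op ⋙ R.yon := by
  have hom_heq : ∀ {I I' J J' : R.Inst} (α : I ⟶ J) (β : I' ⟶ J') (_ : I = I') (_ : J = J'),
      (∀ x, α.hom.app x ≍ β.hom.app x) → α ≍ β := by
    rintro I _ J _ α β rfl rfl h
    refine heq_of_eq ?_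
    ext x : 3
    exact eq_of_heq (h x)
  have hobj : ∀ X, (S.inT.op ⋙ S.yon ⋙ F.delta).obj X = (R.inT.op ⋙ R.yon).obj X := by
    intro X
    refine ObjectProperty.FullSubcategory.ext (Functor.hext ?_ ?_)
    · rintro (c | d) <;> rfl
    · rintro (c | d) (c' | d') f
      · refine heq_of_eq ?_
        ext x
        exact PEmpty.elim x
      · refine heq_of_eq ?_
        ext x
        exact PEmpty.elim x
      · exact PEmpty.elim f
      · rfl
  refine Functor.hext hobj (fun X Y f => hom_heq _ _ (hobj X) (hobj Y) ?_)
  rintro (c | d)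
  · refine heq_of_eq ?_
    ext x
    exact PEmpty.elim x
  · rfl

end Mapping

end Schema

/-! ### Bimodules and the 2-cells between them -/

/-- A bimodule between schemas: a functor from (the opposite of) the collage of the first to the
instances on the second that sends each type to the instance it represents. -/
structure Bimodule {T : Type u} [SmallCategory T] (R S : Schema T) where
  /-- The underlying functor. -/
  functor : R.Colᵒᵖ ⥤ S.Inst
  type_eq : R.inT.op ⋙ functor = S.inT.op ⋙ S.yon

namespace Bimodule

variable {T : Type u} [SmallCategory T]

section
variable {R S : Schema T}

/-- A morphism of bimodules: a natural transformation that is the identity on types. -/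
@[ext]
structure Hom (M N : Bimodule R S) where
  /-- The underlying natural transformation. -/
  nat : M.functor ⟶ N.functor
  type_eq : Functor.whiskerLeft R.inT.op nat = eqToHom (M.type_eq.trans N.type_eq.symm)

/-- The category of bimodules between two schemas. -/
instance : Category (Bimodule R S) where
  Hom := Hom
  id M := ⟨𝟙 M.functor, by simp⟩
  comp φ ψ := ⟨φ.nat ≫ ψ.nat, by
    rw [Functor.whiskerLeft_comp, φ.type_eq, ψ.type_eq, eqToHom_trans]⟩
  id_comp φ := Hom.ext (Category.id_comp φ.nat)
  comp_id φ := Hom.ext (Category.comp_id φ.nat)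
  assoc φ ψ χ := Hom.ext (Category.assoc φ.nat ψ.nat χ.nat)

/-- The profunctor between collages that underlies a bimodule. -/
def prof (M : Bimodule R S) : Prof R.Col S.Col := M.functor ⋙ S.IsInstance.ι

/-- The entity part of a bimodule. -/
def ent (M : Bimodule R S) : Prof R.Ent S.Ent := (Prof.restrict R.inE S.inE).obj M.prof

/-- The type part of a bimodule. -/
def typ (M : Bimodule R S) : Prof R.Ent T := (Prof.restrict R.inE S.inT).obj M.prof

/-- The type part of a bimodule is an algebraic profunctor. -/
theorem typ_algebraic (M : Bimodule R S) (r : R.Entᵒᵖ) : PreservesFiniteProducts (M.typ.obj r) :=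
  (M.functor.obj (R.inE.op.obj r)).property

/-- The action of observables of `S` on a bimodule: `(m, a) ∈ M(r, s) × S(s, τ)` is sent to
`M(r, a)(m) ∈ M(r, τ)`. -/
def att (M : Bimodule R S) : M.ent.comp S.obs ⟶ M.typ where
  app r :=
    { app := fun τ => ↾(Quot.lift
        (fun x => (M.prof.obj (R.inE.op.obj r)).map (Prof.Collage.ofElem x.2.2) x.2.1) (by
          rintro _ _ ⟨f, p, q⟩
          exact (ConcreteCategory.congr_hom ((M.prof.obj (R.inE.op.obj r)).map_comp
            (S.inE.map f) (Prof.Collage.ofElem q)) p).symm))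
      naturality := by
        intro τ τ' g
        ext ⟨x⟩
        exact ConcreteCategory.congr_hom ((M.prof.obj (R.inE.op.obj r)).map_comp
          (Prof.Collage.ofElem x.2.2) (S.inT.map g)) x.2.1 }
  naturality := by
    intro r r' f
    ext τ ⟨x⟩
    exact (NatTrans.naturality_apply (M.prof.map (R.inE.op.map f))
      (Prof.Collage.ofElem x.2.2) x.2.1).symm

/-- The element of `M(τ, τ)` that corresponds to the identity of the type `τ`. -/
def unitElem (M : Bimodule R S) (τ : T) :
    (M.prof.obj (R.inT.op.obj (op τ))).obj (S.inT.obj τ) :=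
  ((eqToHom M.type_eq.symm).app (op τ)).hom.app (S.inT.obj τ) (𝟙 (S.inT.obj τ))

theorem unitElem_map (M : Bimodule R S) {τ τ' : T} (g : τ ⟶ τ') :
    (M.prof.obj (R.inT.op.obj (op τ))).map (S.inT.map g) (M.unitElem τ) =
      (M.prof.map (R.inT.map g).op).app (S.inT.obj τ') (M.unitElem τ') := by
  have h1 := NatTrans.naturality_apply ((eqToHom M.type_eq.symm).app (op τ)).hom (S.inT.map g)
    (𝟙 (S.inT.obj τ))
  have h2 := ConcreteCategory.congr_hom (NatTrans.congr_app (congrArg InducedCategory.Hom.hom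
    ((eqToHom M.type_eq.symm).naturality g.op)) (S.inT.obj τ')) (𝟙 (S.inT.obj τ'))
  refine h1.symm.trans (Eq.trans ?_ h2)
  refine congrArg (((eqToHom M.type_eq.symm).app (op τ)).hom.app (S.inT.obj τ')) ?_
  exact (Category.id_comp (S.inT.map g)).trans (Category.comp_id (S.inT.map g)).symm

/-- The action of observables of `R` on a bimodule: `a ∈ R(r, τ)` is sent to the image of the
identity of `τ` under `M(a, τ) : M(τ, τ) → M(r, τ)`. -/
def ret (M : Bimodule R S) : R.obs ⟶ M.typ where
  app r :=
    { app := fun τ => ↾(fun a =>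
        (M.prof.map (Prof.Collage.ofElem (c := r.unop) a).op).app (S.inT.obj τ) (M.unitElem τ))
      naturality := by
        intro τ τ' g
        ext a
        let a' := Prof.Collage.ofElem (c := r.unop) a
        have h1 := ConcreteCategory.congr_hom (NatTrans.congr_app
          (M.prof.map_comp (R.inT.map g).op a'.op) (S.inT.obj τ')) (M.unitElem τ')
        have h2 := NatTrans.naturality_apply (M.prof.map a'.op) (S.inT.map g) (M.unitElem τ)
        refine h1.trans (Eq.trans ?_ h2)
        exact congrArg ((M.prof.map a'.op).app (S.inT.obj τ')) (M.unitElem_map g).symm }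
  naturality := by
    intro r r' f
    ext τ a
    exact ConcreteCategory.congr_hom (NatTrans.congr_app (M.prof.map_comp
      (Prof.Collage.ofElem (c := r.unop) a).op (R.inE.op.map f)) (S.inT.obj τ)) (M.unitElem τ)

end

section
variable {R S R' S' R'' S'' : Schema T}

/-- Restriction of bimodules along schema mappings, on objects. -/
def restrictObj (F : R.Mapping R') (G : S.Mapping S') (N : Bimodule R' S') : Bimodule R S where
  functor := F.col.op ⋙ N.functor ⋙ G.delta
  type_eq := by
    have h : R.inT.op ⋙ F.col.op ⋙ N.functor ⋙ G.delta =
        (R'.inT.op ⋙ N.functor) ⋙ G.delta := rfl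
    rw [h, N.type_eq, Functor.assoc, Schema.Mapping.yon_delta]

/-- Restriction of bimodules along schema mappings. -/
def restrict (F : R.Mapping R') (G : S.Mapping S') : Bimodule R' S' ⥤ Bimodule R S where
  obj := restrictObj F G
  map {N N'} φ := ⟨Functor.whiskerLeft F.col.op (Functor.whiskerRight φ.nat G.delta), by
    refine Eq.trans (b := Functor.whiskerRight (Functor.whiskerLeft R'.inT.op φ.nat) G.delta)
      rfl ?_
    rw [φ.type_eq]
    ext x : 2
    simp only [Functor.whiskerRight_app, eqToHom_app, eqToHom_map]
    rfl⟩
  map_id N := Hom.ext (by ext x : 2; exact G.delta.map_id _)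
  map_comp φ ψ := Hom.ext (by ext x : 2; exact G.delta.map_comp _ _)

theorem restrict_restrict (F : R.Mapping R') (G : S.Mapping S') (F' : R'.Mapping R'')
    (G' : S'.Mapping S'') (N : Bimodule R'' S'') :
    (restrict F G).obj ((restrict F' G').obj N) = (restrict (F.comp F') (G.comp G')).obj N := by
  have mk_eq : ∀ {K L : Bimodule R S}, K.functor = L.functor → K = L := by
    rintro ⟨K, hK⟩ ⟨L, hL⟩ h
    cases h
    rfl
  have key : ∀ (A : R.Col ⥤ R''.Col) (_ : A = F.col ⋙ F'.col) (B : S''.Inst ⥤ S.Inst)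
      (_ : B = G'.delta ⋙ G.delta),
      F.col.op ⋙ (F'.col.op ⋙ N.functor ⋙ G'.delta) ⋙ G.delta = A.op ⋙ N.functor ⋙ B := by
    rintro _ rfl _ rfl
    rfl
  exact mk_eq (key _ (F.col_comp F') _ (G.delta_comp G'))

/-- A 2-cell between bimodules with left frame `F` and right frame `G`: a morphism of bimodules
from `M` to the restriction of `N` along `F` and `G`. -/
abbrev Cell (F : R.Mapping R') (G : S.Mapping S') (M : Bimodule R S) (N : Bimodule R' S') :
    Type u :=
  M ⟶ (restrict F G).obj N

/-- Vertical composition of 2-cells between bimodules. -/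
def Cell.vcomp {F : R.Mapping R'} {G : S.Mapping S'} {F' : R'.Mapping R''}
    {G' : S'.Mapping S''} {M : Bimodule R S} {N : Bimodule R' S'} {L : Bimodule R'' S''}
    (θ : Cell F G M N) (η : Cell F' G' N L) : Cell (F.comp F') (G.comp G') M L :=
  θ ≫ (restrict F G).map η ≫ eqToHom (restrict_restrict F G F' G' L)

/-- A 2-cell `θ` with frames `F` and `G` is cartesian if every 2-cell into its codomain whose
frames factor through `F` and `G` factors uniquely through `θ`. -/
def Cell.IsCartesian {F : R.Mapping R'} {G : S.Mapping S'} {M : Bimodule R S}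
    {N : Bimodule R' S'} (θ : Cell F G M N) : Prop :=
  ∀ ⦃X Y : Schema T⦄ (H : X.Mapping R) (K : Y.Mapping S) (L : Bimodule X Y)
    (χ : Cell (H.comp F) (K.comp G) L N), ∃! ψ : Cell H K L M, ψ.vcomp θ = χ

/-- The 2-cell of profunctors between collages that underlies a 2-cell between bimodules. -/
def Cell.prof {F : R.Mapping R'} {G : S.Mapping S'} {M : Bimodule R S} {N : Bimodule R' S'}
    (θ : Cell F G M N) : Prof.Cell F.col G.col M.prof N.prof :=
  Functor.whiskerRight θ.nat S.IsInstance.ι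

/-- The restriction of a 2-cell to entity parts. -/
def Cell.ent {F : R.Mapping R'} {G : S.Mapping S'} {M : Bimodule R S} {N : Bimodule R' S'}
    (θ : Cell F G M N) : Prof.Cell F.ent G.ent M.ent N.ent :=
  (Prof.restrict R.inE S.inE).map θ.prof

/-- The restriction of a 2-cell to type parts. -/
def Cell.typ {F : R.Mapping R'} {G : S.Mapping S'} {M : Bimodule R S} {N : Bimodule R' S'}
    (θ : Cell F G M N) : Prof.Cell F.ent (𝟭 T) M.typ N.typ :=
  (Prof.restrict R.inE S.inT).map θ.prof

/-- The equation between 2-cells `M.ent ⊙ S.obs ⇒ N.typ` relating `att` for `M` and `N`. -/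
def AttCompatible {F : R.Mapping R'} {G : S.Mapping S'} {M : Bimodule R S} {N : Bimodule R' S'}
    (θe : Prof.Cell F.ent G.ent M.ent N.ent) (θt : Prof.Cell F.ent (𝟭 T) M.typ N.typ) : Prop :=
  Prof.Cell.hcomp θe G.obs ≫ (Prof.restrict F.ent (𝟭 T)).map N.att = M.att ≫ θt

/-- The equation between 2-cells `R.obs ⇒ N.typ` relating `ret` for `M` and `N`. -/
def RetCompatible {F : R.Mapping R'} {M : Bimodule R S} {N : Bimodule R' S'}
    (θt : Prof.Cell F.ent (𝟭 T) M.typ N.typ) : Prop :=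
  M.ret ≫ θt = F.obs ≫ (Prof.restrict F.ent (𝟭 T)).map N.ret

end

end Bimodule

/-! A 2-cell framed by `F`, `G` is an ordinary morphism into the restriction of its codomain along
the frames. Both claims are about natural transformations out of `M` that are prescribed on types.

Bijection. Such a transformation is determined by its components at entities `r`, and each of those
is indexed by the entities and types of `S`: exactly the data of `θe` and `θt`. Naturality remains.
Squares along arrows of entities, or of types, are automatic. The square along an observable of `S`
is the equation for `att`. The square along an observable of `R` compares two maps out of `M(τ)`,
which is representable, so by Yoneda it suffices to test the unit element (`hom_ext_unitElem`);
there it is the equation for `ret`.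

Cartesian cells. In both double categories a 2-cell is cartesian exactly when it is invertible as a
morphism into the restriction (the two lemmas `Cell.isCartesian_iff_isIso`). Components at types are
identities, so invertibility is decided on the entity and type parts (`Cell.isIso_iff`). -/

namespace Prof

/-! ### Cartesian 2-cells of profunctors -/

variable {C D C' D' : Type u} [SmallCategory C] [SmallCategory D] [SmallCategory C']
  [SmallCategory D']

/-- Tested on identity frames, the universal property makes postcomposition with `φ` bijective,
which forces an inverse. Conversely, restriction along `H`, `K` is a functor and preserves
invertibility. -/
theorem Cell.isCartesian_iff_isIso {F : C ⥤ C'} {G : D ⥤ D'} {P : Prof C D} {Q : Prof C' D'}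
    (φ : Cell F G P Q) : φ.IsCartesian ↔ IsIso φ := by
  constructor
  · intro h
    have key : ∀ (W : Prof C D) (χ : W ⟶ (restrict F G).obj Q), ∃! ψ : W ⟶ P, ψ ≫ φ = χ :=
      fun W χ => h (𝟭 C) (𝟭 D) W χ
    obtain ⟨s, hs, -⟩ := key _ (𝟙 _)
    -- The section `s` is also a retraction: `φ ≫ s` and the identity both give `φ` when followed by
    -- `φ`.
    refine ⟨s, (key _ φ).unique ?_ (Category.id_comp φ), hs⟩
    rw [Category.assoc, hs, Category.comp_id]
  · intro h A B _ _ H K W χ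
    have key : ∀ χ' : W ⟶ (restrict H K).obj ((restrict F G).obj Q),
        ∃! ψ : W ⟶ (restrict H K).obj P, ψ ≫ (restrict H K).map φ = χ' := fun χ' =>
      ⟨χ' ≫ inv ((restrict H K).map φ), by simp, fun ψ hψ => by simp [← hψ]⟩
    exact key χ

end Prof

/-! ### Identity schema mappings -/

namespace Schema

variable {T : Type u} [SmallCategory T]

theorem Inst.eqToHom_hom_app_heq {S : Schema T} {I J : S.Inst} (h : I = J) (x : S.Col)
    (a : I.obj.obj x) : (eqToHom h).hom.app x a ≍ a := by
  subst h
  rfl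

namespace Mapping

variable {R S : Schema T}

/-- The identity schema mapping. -/
def id (R : Schema T) : R.Mapping R where
  ent := 𝟭 R.Ent
  obs := 𝟙 R.obs

theorem id_comp (F : R.Mapping S) : (Mapping.id R).comp F = F := by
  obtain ⟨F, φ⟩ := F
  exact congrArg (Mapping.mk F) (Category.id_comp φ)

theorem col_id (R : Schema T) : (Mapping.id R).col = 𝟭 R.Col := by
  refine Functor.hext ?_ ?_
  · rintro (c | d) <;> rfl
  · rintro (c | d) (c' | d') f
    · rfl
    · rfl
    · exact PEmpty.elim f
    · rfl

theorem delta_id (R : Schema T) : (Mapping.id R).delta = 𝟭 R.Inst := by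
  -- The functor induced on collages is the identity only propositionally. With a variable `K` in
  -- its place the equality can be substituted, and the claim becomes definitional.
  have key : ∀ (K : R.Col ⥤ R.Col) (_ : K = 𝟭 R.Col)
      (hK : ∀ I, R.IsInstance
        ((R.IsInstance.ι ⋙ (Functor.whiskeringLeft _ _ (Type u)).obj K).obj I)),
      R.IsInstance.lift (R.IsInstance.ι ⋙ (Functor.whiskeringLeft _ _ (Type u)).obj K) hK =
        𝟭 R.Inst := by
    rintro _ rfl hK
    rfl
  exact key _ (col_id R) _

end Mapping

end Schema

/-! ### Cartesian and invertible 2-cells of bimodules -/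

namespace Bimodule

variable {T : Type u} [SmallCategory T] {R S R' S' : Schema T}

theorem ext_functor {M N : Bimodule R S} (h : M.functor = N.functor) : M = N := by
  cases M
  cases N
  cases h
  rfl

theorem Hom.heq_of_nat_heq {M N M' N' : Bimodule R S} (hM : M = M') (hN : N = N')
    {φ : M ⟶ N} {φ' : M' ⟶ N'} (h : Hom.nat φ ≍ Hom.nat φ') : φ ≍ φ' := by
  subst hM hN
  exact heq_of_eq (Hom.ext (eq_of_heq h))

theorem restrict_id (R S : Schema T) :
    restrict (Schema.Mapping.id R) (Schema.Mapping.id S) = 𝟭 (Bimodule R S) := by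
  have key : ∀ (A : R.Col ⥤ R.Col) (_ : A = 𝟭 R.Col) (B : S.Inst ⥤ S.Inst) (_ : B = 𝟭 S.Inst),
      (∀ M : R.Colᵒᵖ ⥤ S.Inst, A.op ⋙ M ⋙ B = M) ∧ ∀ (M N : R.Colᵒᵖ ⥤ S.Inst) (φ : M ⟶ N),
        Functor.whiskerLeft A.op (Functor.whiskerRight φ B) ≍ φ := by
    rintro _ rfl _ rfl
    exact ⟨fun _ => rfl, fun _ _ _ => HEq.rfl⟩
  obtain ⟨hobj, hmap⟩ := key _ (Schema.Mapping.col_id R) _ (Schema.Mapping.delta_id S)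
  have hobj' : ∀ M, (restrict (Schema.Mapping.id R) (Schema.Mapping.id S)).obj M = M :=
    fun M => ext_functor (hobj M.functor)
  exact Functor.hext hobj' fun M N φ => Hom.heq_of_nat_heq (hobj' M) (hobj' N) (hmap _ _ φ.nat)

/-- The argument is the one for profunctors. Restrictions along identity and composite mappings
agree with the expected ones only up to equality of objects, so `eqToHom` isomorphisms have to be
carried along and cancelled. -/
theorem Cell.isCartesian_iff_isIso {F : R.Mapping R'} {G : S.Mapping S'} {M : Bimodule R S}
    {N : Bimodule R' S'} (θ : Cell F G M N) : θ.IsCartesian ↔ IsIso θ := by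
  constructor
  · intro h
    have key : ∀ (L : Bimodule R S) (χ : L ⟶ (Bimodule.restrict F G).obj N),
        ∃! ψ : L ⟶ M, ψ ≫ θ = χ := by
      intro L χ
      have hN : (Bimodule.restrict F G).obj N =
          (Bimodule.restrict ((Schema.Mapping.id R).comp F) ((Schema.Mapping.id S).comp G)).obj
            N := by
        rw [Schema.Mapping.id_comp, Schema.Mapping.id_comp]
      have hM := Functor.congr_obj (restrict_id R S) M
      have hv : ∀ ψ : Cell (Schema.Mapping.id R) (Schema.Mapping.id S) L M,
          ψ.vcomp θ = ((ψ ≫ eqToHom hM) ≫ θ) ≫ eqToHom hN := by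
        intro ψ
        have := Functor.congr_hom (restrict_id R S) θ
        simp only [Cell.vcomp, this]
        simp
      obtain ⟨ψ, hψ, hu⟩ := h _ _ L (χ ≫ eqToHom hN)
      refine ⟨ψ ≫ eqToHom hM, ?_, ?_⟩
      · exact (cancel_mono (eqToHom hN)).1 ((hv ψ).symm.trans hψ)
      · intro ρ hρ
        rw [← hu (ρ ≫ eqToHom hM.symm) (by simp [hv, hρ])]
        simp
    obtain ⟨s, hs, -⟩ := key _ (𝟙 _)
    refine ⟨s, (key _ θ).unique ?_ (Category.id_comp θ), hs⟩
    rw [Category.assoc, hs, Category.comp_id]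
  · intro h X Y H K L χ
    refine ⟨(χ ≫ eqToHom (restrict_restrict H K F G N).symm) ≫
      inv ((Bimodule.restrict H K).map θ), ?_, ?_⟩
    · simp [Cell.vcomp]
    · rintro ψ rfl
      simp [Cell.vcomp]

theorem Cell.isIso_iff {F : R.Mapping R'} {G : S.Mapping S'} {M : Bimodule R S}
    {N : Bimodule R' S'} (θ : Cell F G M N) : IsIso θ ↔ IsIso θ.ent ∧ IsIso θ.typ := by
  constructor
  · intro h
    have hnat : IsIso θ.nat :=
      ⟨(inv θ).nat, congrArg Hom.nat (IsIso.hom_inv_id θ), congrArg Hom.nat (IsIso.inv_hom_id θ)⟩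
    have hprof : IsIso θ.prof := by
      exact Functor.map_isIso ((Functor.whiskeringRight _ _ _).obj S.IsInstance.ι) θ.nat
    constructor
    · unfold Cell.ent
      exact Functor.map_isIso _ _
    · unfold Cell.typ
      exact Functor.map_isIso _ _
  · rintro ⟨he, ht⟩
    have hnat : IsIso θ.nat := by
      have : ∀ r, IsIso (θ.nat.app r) := by
        rintro ⟨r | τ⟩
        -- At an entity of `R`, invertibility is checked at each entity and each type of `S`; at a
        -- type of `R` the component is an `eqToHom`.
        · have hE : IsIso (θ.ent.app (op r)) := inferInstance
          have hT : IsIso (θ.typ.app (op r)) := inferInstance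
          have : ∀ s, IsIso ((S.IsInstance.ι.map (θ.nat.app (op (.left r)))).app s) := by
            rintro (s | τ)
            · exact (inferInstance : IsIso ((θ.ent.app (op r)).app s))
            · exact (inferInstance : IsIso ((θ.typ.app (op r)).app τ))
          have := NatIso.isIso_of_isIso_app (S.IsInstance.ι.map (θ.nat.app (op (.left r))))
          exact isIso_of_fully_faithful S.IsInstance.ι _
        · have h := NatTrans.congr_app θ.type_eq (op τ)
          have : IsIso ((Functor.whiskerLeft R.inT.op θ.nat).app (op τ)) := by
            rw [h]
            infer_instance
          exact this
      exact NatIso.isIso_of_isIso_app _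
    refine ⟨⟨inv θ.nat, ?_⟩, Hom.ext (IsIso.hom_inv_id θ.nat), Hom.ext (IsIso.inv_hom_id θ.nat)⟩
    -- The inverse must again be the identity on types. This follows by cancelling the `eqToHom` to
    -- which `θ.nat` restricts there.
    have h : Functor.whiskerLeft R.inT.op θ.nat ≫ Functor.whiskerLeft R.inT.op (inv θ.nat) =
        𝟙 _ := by
      rw [← Functor.whiskerLeft_comp, IsIso.hom_inv_id]
      rfl
    rw [θ.type_eq] at h
    exact (cancel_epi (eqToHom (M.type_eq.trans ((restrict F G).obj N).type_eq.symm))).1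
      (h.trans (by simp))


/-! ### Unit elements and Yoneda at types -/

theorem unitElem_heq (M : Bimodule R S) (τ : T) : M.unitElem τ ≍ 𝟙 τ := by
  have h : ∀ {I J : S.Inst} (φ : I ⟶ J) (h : I = J) (_ : φ = eqToHom h) (a : I.obj.obj (S.inT.obj τ)),
      φ.hom.app (S.inT.obj τ) a ≍ a := by
    rintro I _ _ rfl rfl a
    rfl
  exact h _ (Functor.congr_obj M.type_eq.symm (op τ)) (eqToHom_app _ _) (𝟙 (S.inT.obj τ))

theorem type_app_hom_app_heq {M N : Bimodule R S}
    {φ : R.inT.op ⋙ M.functor ⟶ R.inT.op ⋙ N.functor}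
    (hφ : φ = eqToHom (M.type_eq.trans N.type_eq.symm)) (τ : T) (x : S.Col)
    (a : (M.functor.obj (op (.right τ))).obj.obj x) :
    (φ.app (op τ)).hom.app x a ≍ a := by
  rw [hφ, eqToHom_app]
  exact Schema.Inst.eqToHom_hom_app_heq _ _ _

/-- The unit element generates `M(τ)`: under the identification with the instance represented by
`τ`, an element `m` is itself an arrow out of `τ`, and that arrow is the witness. -/
theorem exists_map_unitElem (M : Bimodule R S) (τ : T) (x : S.Col)
    (m : (M.prof.obj (op (.right τ))).obj x) :
    ∃ f : S.inT.obj τ ⟶ x, (M.prof.obj (op (.right τ))).map f (M.unitElem τ) = m := by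
  let E := (eqToHom M.type_eq.symm).app (op τ)
  let E' := (eqToHom M.type_eq).app (op τ)
  have h1 : E' ≫ E = 𝟙 _ := by simp [E, E']
  have h2 : E.hom.app x (E'.hom.app x m) = m :=
    ConcreteCategory.congr_hom (NatTrans.congr_app (congrArg InducedCategory.Hom.hom h1) x) m
  refine ⟨E'.hom.app x m, ?_⟩
  refine Eq.trans (NatTrans.naturality_apply E.hom (E'.hom.app x m : S.inT.obj τ ⟶ x)
    (𝟙 (S.inT.obj τ))).symm (Eq.trans ?_ h2)
  exact congrArg (E.hom.app x) (Category.id_comp (E'.hom.app x m : S.inT.obj τ ⟶ x))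

theorem hom_ext_unitElem {M : Bimodule R S} {τ : T} {J : S.Inst}
    {φ ψ : M.functor.obj (op (.right τ)) ⟶ J}
    (h : φ.hom.app (S.inT.obj τ) (M.unitElem τ) = ψ.hom.app (S.inT.obj τ) (M.unitElem τ)) :
    φ = ψ := by
  ext x m
  obtain ⟨f, rfl⟩ := M.exists_map_unitElem τ x m
  exact (NatTrans.naturality_apply φ.hom f (M.unitElem τ)).trans
    ((congrArg (J.obj.map f) h).trans (NatTrans.naturality_apply ψ.hom f (M.unitElem τ)).symm)

/-- The hypothesis on `φ` covers both a given 2-cell, through its `type_eq`, and the bare `eqToHom`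
used in `Cell.ofParts`. -/
theorem hom_app_unitElem {M N : Bimodule R S}
    {φ : R.inT.op ⋙ M.functor ⟶ R.inT.op ⋙ N.functor}
    (hφ : φ = eqToHom (M.type_eq.trans N.type_eq.symm)) (τ : T) :
    (φ.app (op τ)).hom.app (S.inT.obj τ) (M.unitElem τ) = N.unitElem τ :=
  eq_of_heq ((type_app_hom_app_heq hφ τ _ _).trans
    ((unitElem_heq M τ).trans (unitElem_heq N τ).symm))

theorem restrict_unitElem (F : R.Mapping R') (G : S.Mapping S') (N : Bimodule R' S') (τ : T) :
    ((restrict F G).obj N).unitElem τ = N.unitElem τ :=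
  eq_of_heq ((unitElem_heq ((restrict F G).obj N) τ).trans (unitElem_heq N τ).symm)

/-- This absorbs the frames: `RetCompatible` becomes compatibility of `θt` with `ret` of `M` and of
the restricted bimodule. -/
theorem restrict_ret (F : R.Mapping R') (G : S.Mapping S') (N : Bimodule R' S') :
    ((restrict F G).obj N).ret = F.obs ≫ (Prof.restrict F.ent (𝟭 T)).map N.ret := by
  ext r τ a
  exact congrArg ((((restrict F G).obj N).prof.map
    (Prof.Collage.ofElem (c := r.unop) a).op).app (S.inT.obj τ)) (restrict_unitElem F G N τ)

/-! ### Necessity of the equations, and injectivity -/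

theorem Cell.attCompatible {F : R.Mapping R'} {G : S.Mapping S'} {M : Bimodule R S}
    {N : Bimodule R' S'} (θ : Cell F G M N) : AttCompatible θ.ent θ.typ := by
  unfold AttCompatible
  ext r τ ⟨s, m, a⟩
  exact (NatTrans.naturality_apply (θ.nat.app (op (.left r.unop))).hom
    (Prof.Collage.ofElem a) m).symm

theorem Cell.retCompatible {F : R.Mapping R'} {G : S.Mapping S'} {M : Bimodule R S}
    {N : Bimodule R' S'} (θ : Cell F G M N) : RetCompatible θ.typ := by
  unfold RetCompatible
  refine Eq.trans ?_ (restrict_ret F G N)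
  ext r τ a
  let a' := Prof.Collage.ofElem (c := r.unop) a
  -- Naturality of `θ` along the observable `a`, evaluated at the unit element, which `θ` preserves.
  have h := ConcreteCategory.congr_hom (NatTrans.congr_app (θ.prof.naturality a'.op)
    (S.inT.obj τ)) (M.unitElem τ)
  refine Eq.trans h ?_
  exact congrArg ((((restrict F G).obj N).prof.map a'.op).app (S.inT.obj τ))
    (hom_app_unitElem θ.type_eq τ)

theorem Cell.ext_ent_typ {F : R.Mapping R'} {G : S.Mapping S'} {M : Bimodule R S}
    {N : Bimodule R' S'} {θ η : Cell F G M N} (he : θ.ent = η.ent) (ht : θ.typ = η.typ) :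
    θ = η := by
  refine Hom.ext ?_
  ext ⟨r | τ⟩ : 2
  · ext (s | τ) : 3
    · exact NatTrans.congr_app (NatTrans.congr_app he (op r)) s
    · exact NatTrans.congr_app (NatTrans.congr_app ht (op r)) τ
  · exact NatTrans.congr_app (θ.type_eq.trans η.type_eq.symm) (op τ)

/-! ### Construction of a 2-cell from compatible parts -/

section ofParts

variable {F : R.Mapping R'} {G : S.Mapping S'} {M : Bimodule R S} {N : Bimodule R' S'}
  (θe : Prof.Cell F.ent G.ent M.ent N.ent) (θt : Prof.Cell F.ent (𝟭 T) M.typ N.typ)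

/-- The morphism of instances at an entity that is determined by compatible 2-cells between
entity parts and type parts. -/
def Cell.ofPartsApp (hatt : AttCompatible (G := G) θe θt) (r : R.Ent) :
    M.functor.obj (op (.left r)) ⟶ ((restrict F G).obj N).functor.obj (op (.left r)) :=
  ObjectProperty.homMk
    { app := fun
        | .left s => (θe.app (op r)).app s
        | .right τ => (θt.app (op r)).app τ
      naturality := by
        rintro (s | τ) (s' | τ') f
        · exact (θe.app (op r)).naturality f
        · ext m
          -- For an observable `f` of `S`, the square at `m` is the `att` equation at the class of
          -- `(m, f)` in the coend.
          exact (ConcreteCategory.congr_hom (NatTrans.congr_app (NatTrans.congr_app hatt (op r)) τ')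
            (Quot.mk _ ⟨s, m, f⟩)).symm
        · exact PEmpty.elim f
        · exact (θt.app (op r)).naturality f }

/-- The 2-cell of bimodules that is determined by compatible 2-cells between entity parts and
type parts. -/
def Cell.ofParts (hatt : AttCompatible (G := G) θe θt) (hret : RetCompatible θt) :
    Cell F G M N where
  nat :=
    { app := fun
        | op (.left r) => Cell.ofPartsApp θe θt hatt r
        | op (.right τ) =>
          (eqToHom (M.type_eq.trans ((restrict F G).obj N).type_eq.symm)).app (op τ)
      naturality := by
        rintro ⟨r | τ⟩ ⟨r' | τ'⟩ ⟨f⟩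
        · ext (s | τ) : 3
          · exact NatTrans.congr_app (θe.naturality (Quiver.Hom.op (f : r' ⟶ r))) s
          · exact NatTrans.congr_app (θt.naturality (Quiver.Hom.op (f : r' ⟶ r))) τ
        · exact PEmpty.elim f
        -- Here `f` is an observable of `R` from `r'` to `τ`. Both composites start at `M(τ)`, so
        -- the unit element suffices, and there the `ret` equation applies.
        · refine hom_ext_unitElem (Eq.trans
            (ConcreteCategory.congr_hom (NatTrans.congr_app (NatTrans.congr_app
              (hret.trans (restrict_ret F G N).symm) (op r')) τ) f) ?_)
          exact congrArg ((((restrict F G).obj N).prof.map (Quiver.Hom.op f)).app (S.inT.obj τ))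
            (hom_app_unitElem rfl τ).symm
        · exact (eqToHom (M.type_eq.trans ((restrict F G).obj N).type_eq.symm)).naturality
            (Quiver.Hom.op (f : τ' ⟶ τ)) }
  type_eq := by
    ext τ : 2
    rfl

end ofParts

end Bimodule

theorem mainTheorem11 {T : Type u} [SmallCategory T] [HasFiniteProducts T]
    {R S R' S' : Schema T} (F : R.Mapping R') (G : S.Mapping S')
    (M : Bimodule R S) (N : Bimodule R' S') :
    (∃ e : Bimodule.Cell F G M N ≃
        {p : Prof.Cell F.ent G.ent M.ent N.ent × Prof.Cell F.ent (𝟭 T) M.typ N.typ //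
          Bimodule.AttCompatible p.1 p.2 ∧ Bimodule.RetCompatible p.2},
      ∀ θ : Bimodule.Cell F G M N, (e θ).1 = (θ.ent, θ.typ)) ∧
    (∀ θ : Bimodule.Cell F G M N,
      θ.IsCartesian ↔ θ.ent.IsCartesian ∧ θ.typ.IsCartesian) := by
  refine ⟨⟨Equiv.ofBijective
    (fun θ => ⟨(θ.ent, θ.typ), θ.attCompatible, θ.retCompatible⟩) ⟨?_, ?_⟩, fun _ => rfl⟩, ?_⟩
  · intro θ η h
    have h' := congrArg Subtype.val h
    exact Bimodule.Cell.ext_ent_typ (congrArg Prod.fst h') (congrArg Prod.snd h')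
  · rintro ⟨⟨θe, θt⟩, hatt, hret⟩
    -- The parts of the constructed 2-cell are the given ones by definition.
    exact ⟨Bimodule.Cell.ofParts θe θt hatt hret, rfl⟩
  · intro θ
    rw [Bimodule.Cell.isCartesian_iff_isIso, Bimodule.Cell.isIso_iff,
      Prof.Cell.isCartesian_iff_isIso, Prof.Cell.isCartesian_iff_isIso]
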